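/- For $F\in[0,1]$ let $$\rho_2^{iso}(F)=F\,|\psi^+\rangle\langle\psi^+|+(1-F)\,\frac{I_4-|\psi^+\rangle\langle\psi^+|}{3},\qquad |\psi^+\rangle=\tfrac{1}{\sqrt2}(|00\rangle+|11\rangle),$$ be the two-qubit isotropic state, shared by Alice (first qubit) and Bob (second qubit). For a density matrix $\rho$ and $\alpha\in(0,1)$ let $S^{\mathcal K}_\alpha(\rho)=\frac{1}{2\alpha}\mathrm{Tr}[\rho^{1-\alpha}-\rho^{1+\alpha}]$ be the quantum Kaniadakis $\alpha$-entropy, and for a bipartite state let $S^{\mathcal K}_\alpha(A|B)_{\rho_{AB}}=S^{\mathcal K}_\alpha(\rho_{AB})-S^{\mathcal K}_\alpha(\rho_B)$, where $\rho_B=\mathrm{Tr}_A\,\rho_{AB}$. A bipartite state $\rho_{AB}$ is called steerable for projective measurements if there is a finite collection of projective measurements $\{A_{a|x}\}_a$ of Alice such that the assemblage $\rho_{a|x}=\mathrm{Tr}_A[(A_{a|x}\otimes I)\rho_{AB}]$ has no local hidden state model, i.e. cannot be written as $\rho_{a|x}=\int \rho_\lambda\,p_A(a|x,\lambda)\,d\pi(\lambda)$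 for all $a,x$, with a probability distribution $\pi$, density matrices $\rho_\lambda$ of Bob and response functions $p_A(a|x,\lambda)\ge 0$ with $\sum_a p_A(a|x,\lambda)=1$. A state $\rho$ is called $k$-copy steerable for projective measurements if $\rho^{\otimes k}$, with all first subsystems held by Alice and all second subsystems held by Bob, is steerable for projective measurements (Alice may measure her $k$ subsystems collectively). Proposition. Let $k\ge 7$, $\alpha\in(0,1)$ and $F\in[0,1]$. If $S^{\mathcal K}_\alpha(A|B)_{\rho_2^{iso}(F)}<0$, then $\rho_2^{iso}(F)$ is $k$-copy steerable for projective measurements. -/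

import Mathlib

open scoped Kronecker ComplexOrder

universe u

noncomputable section

namespace QSteer

variable {m n : Type*} [Fintype m] [DecidableEq m] [Fintype n] [DecidableEq n]

/-- Density matrices: positive semidefinite (in particular Hermitian) with trace one. -/
structure IsDensityMatrix (ρ : Matrix m m ℂ) : Prop where
  posSemidef : ρ.PosSemidef
  trace_eq_one : ρ.trace = 1

/-- Partial trace over the first factor (Alice's system) of an operator on `ℂ^m ⊗ ℂ^n`. -/
def traceA (ρ : Matrix (m × n) (m × n) ℂ) : Matrix n n ℂ :=
  Matrix.of fun j j' => ∑ i, ρ (i, j) (i, j')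

/-- The quantum Kaniadakis `α`-entropy `(1 / 2α) Tr[ρ^(1-α) - ρ^(1+α)]`; the powers of the
positive semidefinite matrix `ρ` are taken by the functional calculus. -/
def kaniadakisEntropy (α : ℝ) (ρ : Matrix m m ℂ) : ℝ :=
  1 / (2 * α) *
    (Matrix.trace (cfc (fun x : ℝ => x ^ (1 - α)) ρ - cfc (fun x : ℝ => x ^ (1 + α)) ρ)).re

/-- The conditional quantum Kaniadakis `α`-entropy `S(A|B) = S(ρ_AB) - S(ρ_B)`. -/
def condKaniadakisEntropy (α : ℝ) (ρ : Matrix (m × n) (m × n) ℂ) : ℝ :=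
  kaniadakisEntropy α ρ - kaniadakisEntropy α (traceA ρ)

/-- The vector `ψ_d^+ = (1 / √d) ∑ i, |i i⟩` in `ℂ^d ⊗ ℂ^d`. -/
def maxEntangled (d : ℕ) : Fin d × Fin d → ℂ :=
  fun p => if p.1 = p.2 then ((1 / Real.sqrt d : ℝ) : ℂ) else 0

/-- The rank-one projection `|ψ_d^+⟩⟨ψ_d^+|`. -/
def maxEntangledProj (d : ℕ) : Matrix (Fin d × Fin d) (Fin d × Fin d) ℂ :=
  Matrix.vecMulVec (maxEntangled d) (star (maxEntangled d))

/-- The isotropic state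
`F |ψ_d^+⟩⟨ψ_d^+| + (1 - F) (I - |ψ_d^+⟩⟨ψ_d^+|) / (d^2 - 1)`. -/
def isotropicState (d : ℕ) (F : ℝ) : Matrix (Fin d × Fin d) (Fin d × Fin d) ℂ :=
  (F : ℂ) • maxEntangledProj d +
    (((1 - F) / ((d : ℝ) ^ 2 - 1) : ℝ) : ℂ) • (1 - maxEntangledProj d)

/-- The state `ρ^{⊗ k}` of `k` copies of a bipartite state, regarded as a bipartite state: Alice
holds all the first factors, `(ℂ^m)^{⊗ k}`, and Bob all the second ones, `(ℂ^n)^{⊗ k}`. -/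
def copies (k : ℕ) (ρ : Matrix (m × n) (m × n) ℂ) :
    Matrix ((Fin k → m) × (Fin k → n)) ((Fin k → m) × (Fin k → n)) ℂ :=
  Matrix.of fun p q => ∏ i, ρ (p.1 i, p.2 i) (q.1 i, q.2 i)

/-- A projective measurement with outcomes `a : O`: mutually orthogonal Hermitian projections
that sum to the identity. -/
structure IsProjectiveMeasurement {O : Type*} [Fintype O] (P : O → Matrix m m ℂ) : Prop where
  isHermitian : ∀ a, (P a).IsHermitian
  projections : CompleteOrthogonalIdempotents P

/-- The assemblage `ρ_{a|x} = Tr_A[(A_{a|x} ⊗ I) ρ_AB]` of unnormalised conditional states of Bob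
when Alice performs the measurement `x` and obtains the outcome `a`. -/
def assemblage {X O : Type*} (ρ : Matrix (m × n) (m × n) ℂ) (M : X → O → Matrix m m ℂ)
    (x : X) (a : O) : Matrix n n ℂ :=
  traceA ((M x a ⊗ₖ (1 : Matrix n n ℂ)) * ρ)

/-- The assemblage `σ` decomposes as `σ_{a|x} = ∫ p(a|x,l) τ_l dμ(l)` for a hidden variable `l`
with probability distribution `μ`, hidden states `τ_l` of Bob and response functions
`p(a|x,l)` of Alice. -/
def HasLHSModel {X O : Type*} [Fintype O] (σ : X → O → Matrix n n ℂ) : Prop :=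
  ∃ (Λ : Type u) (_ : MeasurableSpace Λ) (μ : MeasureTheory.Measure Λ)
    (τ : Λ → Matrix n n ℂ) (p : X → O → Λ → ℝ),
    MeasureTheory.IsProbabilityMeasure μ ∧
    (∀ l, IsDensityMatrix (τ l)) ∧
    (∀ i j, Measurable fun l => τ l i j) ∧
    (∀ x a, Measurable (p x a)) ∧
    (∀ x a l, 0 ≤ p x a l) ∧
    (∀ x l, ∑ a, p x a l = 1) ∧
    ∀ x a i j, σ x a i j = ∫ l, (p x a l : ℂ) * τ l i j ∂μ

/-- A bipartite state is steerable (from Alice to Bob) for projective measurements: for some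
finite selection of projective measurements of Alice, the assemblage observed on Bob's side has
no local hidden state model. -/
def IsSteerableProjective (ρ : Matrix (m × n) (m × n) ℂ) : Prop :=
  ∃ (r s : ℕ) (M : Fin r → Fin s → Matrix m m ℂ),
    (∀ x, IsProjectiveMeasurement (M x)) ∧ ¬ HasLHSModel.{u} (assemblage ρ M)

/-- A bipartite state `ρ` is `k`-copy steerable for projective measurements: `ρ^{⊗ k}` is steerable
by projective measurements that act collectively on Alice's parts of all the copies. -/
def IsKCopySteerableProjective (k : ℕ) (ρ : Matrix (m × n) (m × n) ℂ) : Prop :=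
  IsSteerableProjective.{u} (copies k ρ)

end QSteer

end

open MeasureTheory

set_option linter.unusedSectionVars false

noncomputable section

namespace QSteer

variable {m n : Type*} [Fintype m] [DecidableEq m] [Fintype n] [DecidableEq n]

/-! One copy is already steerable, so Alice need only measure the first of her `k ≥ 1` systems. The
bridge from entropy to steering is purity.

Bob's marginal is `I/2`. Writing `S_α = (1/2α) ∑ pᵢ g(pᵢ^α)` with `g(t) = t⁻¹ - t` convex and
decreasing, two applications of Jensen show that purity at most `1/2` gives entropy at least that of
`I/2` (`inv_sub_le_sum_of_purity_le`). A negative conditional entropy therefore forces `F² +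
(1-F)²/3 > 1/2`, which is exactly `(4F-1)² > 3`.

Pauli measurements on the isotropic state give correlations of total strength `4F - 1`, while a
local hidden state model allows at most `√3`: a Bloch vector of length at most 1 against a response
vector in the cube `[-1,1]³`. Finally, tracing out Bob's other copies turns a hidden state model for
`k` copies into one for a single copy. -/

/-! ### Entropies of the isotropic state and of its marginal. -/

/-- The functional calculus of a combination of complementary projections. -/
theorem cfc_starProjection_combination {P : Matrix m m ℂ} (hP : IsStarProjection P) (f : ℝ → ℝ)
    (x y : ℝ) :
    cfc f ((x : ℂ) • P + (y : ℂ) • (1 - P)) = (f x : ℂ) • P + (f y : ℂ) • (1 - P) := by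
  have affine : ∀ a b : ℝ,
      cfc (fun t : ℝ => a * t + b * (1 - t)) P = (a : ℂ) • P + (b : ℂ) • (1 - P) := by
    intro a b
    have e : (fun t : ℝ => a * t + b * (1 - t)) = fun t : ℝ => (a - b) * t + b := by
      ext t; ring
    have hs : IsSelfAdjoint P := hP.isSelfAdjoint
    rw [e, cfc_add (a := P) (fun t : ℝ => (a - b) * t) (fun _ => b), cfc_const_mul (a - b) (fun t : ℝ => t) P, cfc_id' ℝ P,
      cfc_const b P]
    ext i j
    simp only [Matrix.add_apply, Matrix.smul_apply, Matrix.sub_apply, Matrix.algebraMap_matrix_apply,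
      Matrix.one_apply, Complex.real_smul, smul_eq_mul, Complex.ofReal_sub]
    split_ifs <;> simp <;> ring
  have hs : IsSelfAdjoint P := hP.isSelfAdjoint
  -- On a finite spectrum every `f` is continuous, so `f` can be arbitrary.
  have hfin : (spectrum ℝ P).Finite := Matrix.finite_real_spectrum
  rw [← affine x y, ← cfc_comp f (fun t : ℝ => x * t + y * (1 - t)) P hs
    ((hfin.image _).continuousOn _), ← affine]
  refine cfc_congr fun t ht => ?_
  rcases hP.isIdempotentElem.spectrum_subset ℝ ht with rfl | rfl <;> simp

theorem kaniadakisEntropy_starProjection_combination {P : Matrix m m ℂ} (hP : IsStarProjection P)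
    (α x y : ℝ) :
    kaniadakisEntropy α ((x : ℂ) • P + (y : ℂ) • (1 - P)) =
      1 / (2 * α) * ((x ^ (1 - α) - x ^ (1 + α)) * P.trace.re +
        (y ^ (1 - α) - y ^ (1 + α)) * (1 - P).trace.re) := by
  rw [kaniadakisEntropy, cfc_starProjection_combination hP, cfc_starProjection_combination hP]
  simp only [Matrix.trace_sub, Matrix.trace_add, Matrix.trace_smul, smul_eq_mul, Complex.sub_re,
    Complex.add_re, Complex.re_ofReal_mul]
  ring

theorem isStarProjection_maxEntangledProj_two : IsStarProjection (maxEntangledProj 2) := by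
  have hs : ((√2 : ℝ) : ℂ)⁻¹ * ((√2 : ℝ) : ℂ)⁻¹ = 1 / 2 := by
    rw [← mul_inv, ← Complex.ofReal_mul, Real.mul_self_sqrt (by norm_num)]; norm_num
  constructor
  · ext ⟨i, i'⟩ ⟨j, j'⟩
    fin_cases i <;> fin_cases i' <;> fin_cases j <;> fin_cases j' <;>
      simp [maxEntangledProj, Matrix.mul_apply, Matrix.vecMulVec_apply, maxEntangled,
        Fintype.sum_prod_type, hs]
  · ext p q
    simp [maxEntangledProj, Matrix.star_apply, Matrix.vecMulVec_apply, mul_comm]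

theorem maxEntangledProj_two_apply (p q : Fin 2 × Fin 2) :
    maxEntangledProj 2 p q = if p.1 = p.2 ∧ q.1 = q.2 then 1 / 2 else 0 := by
  have hs : ((√2 : ℝ) : ℂ)⁻¹ * ((√2 : ℝ) : ℂ)⁻¹ = 1 / 2 := by
    rw [← mul_inv, ← Complex.ofReal_mul, Real.mul_self_sqrt (by norm_num)]; norm_num
  by_cases hp : p.1 = p.2 <;> by_cases hq : q.1 = q.2 <;>
    simp [maxEntangledProj, Matrix.vecMulVec_apply, maxEntangled, hp, hq]
  simpa using hs

theorem trace_maxEntangledProj_two : (maxEntangledProj 2).trace = 1 := by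
  simp [Matrix.trace, maxEntangledProj_two_apply, Fintype.sum_prod_type]

theorem traceA_isotropicState_two (F : ℝ) :
    traceA (isotropicState 2 F) = ((1 / 2 : ℝ) : ℂ) • (1 : Matrix (Fin 2) (Fin 2) ℂ) := by
  ext i j
  fin_cases i <;> fin_cases j <;>
    simp [traceA, isotropicState, maxEntangledProj_two_apply, Matrix.one_apply] <;> ring

theorem trace_isotropicState_two (F : ℝ) : (isotropicState 2 F).trace = 1 := by
  simp [isotropicState, Matrix.trace_add, Matrix.trace_smul, trace_maxEntangledProj_two]
  ring

theorem kaniadakisEntropy_isotropicState_two (α F : ℝ) :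
    kaniadakisEntropy α (isotropicState 2 F) =
      1 / (2 * α) * ((F ^ (1 - α) - F ^ (1 + α)) +
        3 * (((1 - F) / 3) ^ (1 - α) - ((1 - F) / 3) ^ (1 + α))) := by
  rw [isotropicState, kaniadakisEntropy_starProjection_combination
    isStarProjection_maxEntangledProj_two]
  simp [Matrix.trace_sub, trace_maxEntangledProj_two]
  norm_num
  left; ring

theorem kaniadakisEntropy_half_one (α : ℝ) :
    kaniadakisEntropy α (((1 / 2 : ℝ) : ℂ) • (1 : Matrix (Fin 2) (Fin 2) ℂ)) =
      1 / (2 * α) * (2 * ((1 / 2 : ℝ) ^ (1 - α) - (1 / 2) ^ (1 + α))) := by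
  have h := kaniadakisEntropy_starProjection_combination
    (IsStarProjection.one (R := Matrix (Fin 2) (Fin 2) ℂ)) α (1 / 2) (1 / 2)
  rw [sub_self, smul_zero, add_zero] at h
  rw [h]
  simp
  left; ring

/-! ### From negative conditional entropy to purity. -/

theorem rpow_one_sub_sub_rpow_one_add {α t : ℝ} (h0 : 0 < α) (h1 : α < 1) (ht : 0 ≤ t) :
    t ^ (1 - α) - t ^ (1 + α) = t * ((t ^ α)⁻¹ - t ^ α) := by
  rcases ht.eq_or_lt with rfl | ht
  · rw [Real.zero_rpow (by linarith), Real.zero_rpow (by linarith)]; simp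
  · rw [Real.rpow_sub ht, Real.rpow_add ht, Real.rpow_one]; ring

/-- Convexity of `t⁻¹ - t`: the gap to the tangent at `c` is `(t - c)² / (c² t)`. -/
theorem tangent_le_inv_sub {c t : ℝ} (hc : 0 < c) (ht : 0 < t) :
    c⁻¹ - c - (1 / c ^ 2 + 1) * (t - c) ≤ t⁻¹ - t := by
  have : t⁻¹ - t - (c⁻¹ - c - (1 / c ^ 2 + 1) * (t - c)) = (t - c) ^ 2 / (c ^ 2 * t) := by
    field_simp; ring
  have h2 : 0 ≤ (t - c) ^ 2 / (c ^ 2 * t) := by positivity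
  linarith

/-- If `p` is a probability distribution with purity `∑ pᵢ²` at most `b`, then
`∑ (pᵢ^(1-α) - pᵢ^(1+α))` is at least its value for the uniform distribution of purity `b`. -/
theorem inv_sub_le_sum_of_purity_le {ι : Type*} [Fintype ι] {α b : ℝ} (h0 : 0 < α) (h1 : α < 1)
    (hb : 0 < b) (p : ι → ℝ) (hp : ∀ i, 0 ≤ p i) (hsum : ∑ i, p i = 1)
    (hpurity : ∑ i, p i ^ 2 ≤ b) :
    (b ^ α)⁻¹ - b ^ α ≤ ∑ i, (p i ^ (1 - α) - p i ^ (1 + α)) := by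
  set c := b ^ α with hc
  have hcpos : 0 < c := Real.rpow_pos_of_pos hb α
  -- Jensen for the concave `x ↦ x^α`, with the `pᵢ` as both weights and points.
  have hmean : ∑ i, p i * p i ^ α ≤ c := by
    have h := (Real.concaveOn_rpow h0.le h1.le).le_map_sum (t := Finset.univ) (w := p) (p := p)
      (fun i _ => hp i) hsum (fun i _ => hp i)
    simp only [smul_eq_mul, ← pow_two] at h
    exact h.trans (Real.rpow_le_rpow (Finset.sum_nonneg fun i _ => sq_nonneg _) hpurity h0.le)
  -- The tangent at `c = b^α` has negative slope, so after averaging the bound `hmean` goes in the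
  -- right direction.
  have hterm : ∀ i, p i * (c⁻¹ - c - (1 / c ^ 2 + 1) * (p i ^ α - c)) ≤
      p i ^ (1 - α) - p i ^ (1 + α) := by
    intro i
    rw [rpow_one_sub_sub_rpow_one_add h0 h1 (hp i)]
    rcases (hp i).eq_or_lt with h | h
    · simp [← h]
    · exact mul_le_mul_of_nonneg_left (tangent_le_inv_sub hcpos (Real.rpow_pos_of_pos h α)) h.le
  refine le_trans ?_ (Finset.sum_le_sum fun i _ => hterm i)
  have e : ∑ i, p i * (c⁻¹ - c - (1 / c ^ 2 + 1) * (p i ^ α - c)) =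
      (c⁻¹ - c) * ∑ i, p i - (1 / c ^ 2 + 1) * (∑ i, p i * p i ^ α - c * ∑ i, p i) := by
    simp only [Finset.mul_sum, ← Finset.sum_sub_distrib]
    exact Finset.sum_congr rfl fun i _ => by ring
  rw [e, hsum]
  have : 0 ≤ (1 / c ^ 2 + 1) * (c - ∑ i, p i * p i ^ α) :=
    mul_nonneg (by positivity) (sub_nonneg.2 hmean)
  nlinarith

/-- Negative conditional Kaniadakis entropy forces the purity of the two-qubit isotropic state to
exceed `1 / 2`. -/
theorem half_lt_purity_of_condKaniadakisEntropy_neg {α F : ℝ} (hα : α ∈ Set.Ioo (0 : ℝ) 1)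
    (hF : F ∈ Set.Icc (0 : ℝ) 1) (h : condKaniadakisEntropy α (isotropicState 2 F) < 0) :
    1 / 2 < F ^ 2 + (1 - F) ^ 2 / 3 := by
  by_contra! hle
  obtain ⟨h0, h1⟩ := hα
  have key := inv_sub_le_sum_of_purity_le h0 h1 (b := 1 / 2) (by norm_num)
    ![F, (1 - F) / 3, (1 - F) / 3, (1 - F) / 3]
    (by have := hF.1; have := hF.2
        intro i; fin_cases i <;> simp <;> linarith)
    (by simp [Fin.sum_univ_succ]; ring)
    (by simp [Fin.sum_univ_succ]; linarith)
  simp only [Fin.sum_univ_succ, Matrix.cons_val_zero, Matrix.cons_val_succ, Fin.sum_univ_zero]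
    at key
  rw [condKaniadakisEntropy, traceA_isotropicState_two, kaniadakisEntropy_isotropicState_two,
    kaniadakisEntropy_half_one, ← mul_sub] at h
  have hp : 0 < 1 / (2 * α) := by positivity
  have h' := neg_of_mul_neg_right h hp.le
  rw [rpow_one_sub_sub_rpow_one_add h0 h1 (t := 1 / 2) (by norm_num)] at h'
  linarith

/-! ### Local hidden state models and linear steering inequalities. -/

/-- Nonnegativity of the `2 × 2` minor gives `|τᵢⱼ|² ≤ τᵢᵢ τⱼⱼ ≤ 1`. This uniform bound makes the
hidden state integrals converge. -/
theorem IsDensityMatrix.norm_apply_le_one {τ : Matrix n n ℂ} (h : IsDensityMatrix τ) (i j : n) :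
    ‖τ i j‖ ≤ 1 := by
  have hdiag : ∀ i, τ i i = ((τ i i).re : ℂ) ∧ 0 ≤ (τ i i).re := fun i => by
    have := Complex.nonneg_iff.1 (h.posSemidef.diag_nonneg (i := i))
    exact ⟨Complex.ext rfl (by simp [← this.2]), this.1⟩
  have hle : ∀ i, (τ i i).re ≤ 1 := by
    intro i
    have ht : ∑ i, (τ i i).re = 1 := by
      have := congrArg Complex.re h.trace_eq_one
      simpa [Matrix.trace] using this
    rw [← ht]
    exact Finset.single_le_sum (f := fun i => (τ i i).re) (fun i _ => (hdiag i).2)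
      (Finset.mem_univ i)
  have hdet := (h.posSemidef.submatrix ![i, j]).det_nonneg
  rw [Matrix.det_fin_two] at hdet
  simp only [Matrix.submatrix_apply, Matrix.cons_val_zero, Matrix.cons_val_one] at hdet
  have hji : τ j i = star (τ i j) := (h.posSemidef.isHermitian.apply j i).symm
  rw [hji, (hdiag i).1, (hdiag j).1, Complex.star_def, Complex.mul_conj] at hdet
  have hn : Complex.normSq (τ i j) ≤ (τ i i).re * (τ j j).re := by
    have := (Complex.nonneg_iff.1 hdet).1
    simpa using this
  rw [Complex.normSq_eq_norm_sq] at hn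
  have : (τ i i).re * (τ j j).re ≤ 1 := mul_le_one₀ (hle i) (hdiag j).2 (hle j)
  nlinarith [norm_nonneg (τ i j)]

theorem integrable_response_mul_state {Λ : Type*} [MeasurableSpace Λ] {μ : Measure Λ}
    [IsProbabilityMeasure μ] {τ : Λ → Matrix n n ℂ} {q : Λ → ℝ}
    (hτ : ∀ l, IsDensityMatrix (τ l)) (hτm : ∀ i j, Measurable fun l => τ l i j)
    (hqm : Measurable q) (hq0 : ∀ l, 0 ≤ q l) (hq1 : ∀ l, q l ≤ 1) (i j : n) :
    Integrable (fun l => (q l : ℂ) * τ l i j) μ := by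
  refine Integrable.of_bound (C := 1)
    ((Complex.measurable_ofReal.comp hqm).mul (hτm i j)).aestronglyMeasurable
    (Filter.Eventually.of_forall fun l => ?_)
  rw [norm_mul, Complex.norm_real, Real.norm_of_nonneg (hq0 l)]
  exact mul_le_one₀ (hq1 l) (norm_nonneg _) ((hτ l).norm_apply_le_one i j)

/-- A linear steering inequality that holds for every hidden state and response function holds for
every assemblage with a local hidden state model. -/
theorem HasLHSModel.steering_inequality {X O : Type*} [Fintype X] [Fintype O]
    {σ : X → O → Matrix n n ℂ} (hσ : HasLHSModel.{u} σ) (w : X → O → Matrix n n ℂ) (C : ℝ)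
    (hC : ∀ (τ : Matrix n n ℂ) (q : X → O → ℝ), IsDensityMatrix τ → (∀ x a, 0 ≤ q x a) →
      (∀ x, ∑ a, q x a = 1) → ∑ x, ∑ a, q x a * (∑ i, ∑ j, w x a i j * τ i j).re ≤ C) :
    ∑ x, ∑ a, (∑ i, ∑ j, w x a i j * σ x a i j).re ≤ C := by
  obtain ⟨Λ, _, μ, τ, p, hμ, hτ, hτm, hpm, hp0, hp1, h⟩ := hσ
  have hple : ∀ x a l, p x a l ≤ 1 := fun x a l => by
    rw [← hp1 x l]
    exact Finset.single_le_sum (f := fun a => p x a l) (fun a _ => hp0 x a l) (Finset.mem_univ a)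
  have hint : ∀ x a i j, Integrable (fun l => w x a i j * ((p x a l : ℂ) * τ l i j)) μ :=
    fun x a i j => (integrable_response_mul_state hτ hτm (hpm x a) (hp0 x a) (hple x a) i j).const_mul _
  have hint2 : ∀ x a, Integrable
      (fun l => ∑ i, ∑ j, w x a i j * ((p x a l : ℂ) * τ l i j)) μ := fun x a =>
    integrable_finsetSum _ fun i _ => integrable_finsetSum _ fun j _ => hint x a i j
  have hxa : ∀ x a, (∑ i, ∑ j, w x a i j * σ x a i j).re =
      ∫ l, p x a l * (∑ i, ∑ j, w x a i j * τ l i j).re ∂μ := by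
    intro x a
    have e1 : ∑ i, ∑ j, w x a i j * σ x a i j =
        ∫ l, ∑ i, ∑ j, w x a i j * ((p x a l : ℂ) * τ l i j) ∂μ := by
      rw [integral_finsetSum _ fun i _ => integrable_finsetSum _ fun j _ => hint x a i j]
      refine Finset.sum_congr rfl fun i _ => ?_
      rw [integral_finsetSum _ fun j _ => hint x a i j]
      refine Finset.sum_congr rfl fun j _ => ?_
      rw [integral_const_mul, h]
    rw [e1, ← RCLike.re_eq_complex_re, ← integral_re (hint2 x a)]
    refine integral_congr_ae (Filter.Eventually.of_forall fun l => ?_)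
    simp only [RCLike.re_eq_complex_re]
    rw [← Complex.re_ofReal_mul]
    congr 1
    simp only [Finset.mul_sum]
    exact Finset.sum_congr rfl fun i _ => Finset.sum_congr rfl fun j _ => by ring
  have hint3 : ∀ x a, Integrable (fun l => p x a l * (∑ i, ∑ j, w x a i j * τ l i j).re) μ := by
    intro x a
    refine (hint2 x a).re.congr (Filter.Eventually.of_forall fun l => ?_)
    simp only [RCLike.re_eq_complex_re]
    rw [← Complex.re_ofReal_mul]
    congr 1
    simp only [Finset.mul_sum]
    exact Finset.sum_congr rfl fun i _ => Finset.sum_congr rfl fun j _ => by ring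
  simp only [hxa]
  have e : ∑ x, ∑ a, ∫ l, p x a l * (∑ i, ∑ j, w x a i j * τ l i j).re ∂μ =
      ∫ l, ∑ x, ∑ a, p x a l * (∑ i, ∑ j, w x a i j * τ l i j).re ∂μ := by
    rw [integral_finsetSum _ fun x _ => integrable_finsetSum _ fun a _ => hint3 x a]
    exact Finset.sum_congr rfl fun x _ => (integral_finsetSum _ fun a _ => hint3 x a).symm
  rw [e]
  calc _ ≤ ∫ _, C ∂μ := integral_mono
        (integrable_finsetSum _ fun x _ => integrable_finsetSum _ fun a _ => hint3 x a)
        (integrable_const C)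
        fun l => hC (τ l) (fun x a => p x a l) (hτ l) (fun x a => hp0 x a l) (fun x => hp1 x l)
    _ = C := by simp

/-! ### Reduction from `k` copies to one. -/

/-- The partial trace of an operator on `k + 1` sites over all sites but the first. -/
def traceTail {k : ℕ} (ρ : Matrix (Fin (k + 1) → n) (Fin (k + 1) → n) ℂ) : Matrix n n ℂ :=
  ∑ v : Fin k → n, ρ.submatrix (fun i => Fin.cons i v) (fun i => Fin.cons i v)

/-- The operator acting as `A` on the first of `k + 1` sites and trivially on the others. -/
def onHead (k : ℕ) (A : Matrix m m ℂ) : Matrix (Fin (k + 1) → m) (Fin (k + 1) → m) ℂ :=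
  (A ⊗ₖ (1 : Matrix (Fin k → m) (Fin k → m) ℂ)).submatrix
    (Fin.consEquiv fun _ => m).symm (Fin.consEquiv fun _ => m).symm

theorem sum_fin_cons {M : Type*} [AddCommMonoid M] {k : ℕ} (f : (Fin (k + 1) → m) → M) :
    ∑ v, f v = ∑ i, ∑ w : Fin k → m, f (Fin.cons i w) := by
  rw [← (Fin.consEquiv fun _ => m).sum_comp, Fintype.sum_prod_type]
  rfl

theorem traceTail_apply {k : ℕ} (ρ : Matrix (Fin (k + 1) → n) (Fin (k + 1) → n) ℂ) (i j : n) :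
    traceTail ρ i j = ∑ v : Fin k → n, ρ (Fin.cons i v) (Fin.cons j v) := by
  simp [traceTail, Matrix.sum_apply]

theorem IsDensityMatrix.traceTail {k : ℕ} {ρ : Matrix (Fin (k + 1) → n) (Fin (k + 1) → n) ℂ}
    (h : IsDensityMatrix ρ) : IsDensityMatrix (traceTail ρ) where
  posSemidef := Matrix.posSemidef_sum _ fun v _ => h.posSemidef.submatrix _
  trace_eq_one := by
    rw [← h.trace_eq_one, Matrix.trace, Matrix.trace, sum_fin_cons]
    simp [traceTail_apply]

/-- The partial trace is linear and preserves density matrices, so the same hidden variable and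
responses work with the reduced hidden states. -/
theorem HasLHSModel.traceTail {X O : Type*} [Fintype O] {k : ℕ}
    {σ : X → O → Matrix (Fin (k + 1) → n) (Fin (k + 1) → n) ℂ} (h : HasLHSModel.{u} σ) :
    HasLHSModel.{u} fun x a => QSteer.traceTail (σ x a) := by
  obtain ⟨Λ, hΛ, μ, τ, p, hμ, hτ, hτm, hpm, hp0, hp1, h⟩ := h
  refine ⟨Λ, hΛ, μ, fun l => QSteer.traceTail (τ l), p, hμ, fun l => (hτ l).traceTail, fun i j => ?_, hpm,
    hp0, hp1, fun x a i j => ?_⟩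
  · simp only [traceTail_apply]
    exact Finset.measurable_fun_sum _ fun v _ => hτm _ _
  · have hple : ∀ l, p x a l ≤ 1 := fun l => by
      rw [← hp1 x l]
      exact Finset.single_le_sum (f := fun a => p x a l) (fun a _ => hp0 x a l)
        (Finset.mem_univ a)
    simp only [traceTail_apply, h, Finset.mul_sum]
    exact (integral_finsetSum _ fun v _ =>
      integrable_response_mul_state hτ hτm (hpm x a) (hp0 x a) hple _ _).symm

theorem onHead_mul (k : ℕ) (A B : Matrix m m ℂ) : onHead k (A * B) = onHead k A * onHead k B := by
  rw [onHead, onHead, onHead, Matrix.submatrix_mul_equiv, ← Matrix.mul_kronecker_mul, one_mul]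

theorem onHead_sum {O : Type*} [Fintype O] (k : ℕ) (A : O → Matrix m m ℂ) :
    onHead k (∑ a, A a) = ∑ a, onHead k (A a) := by
  ext p q
  simp [onHead, Matrix.sum_apply, Finset.sum_mul]

theorem onHead_one (k : ℕ) : onHead k (1 : Matrix m m ℂ) = 1 := by
  rw [onHead, Matrix.one_kronecker_one, Matrix.submatrix_one_equiv]

theorem IsProjectiveMeasurement.onHead {O : Type*} [Fintype O] {P : O → Matrix m m ℂ}
    (h : IsProjectiveMeasurement P) (k : ℕ) :
    IsProjectiveMeasurement fun a => QSteer.onHead k (P a) where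
  isHermitian a := by
    refine Matrix.IsHermitian.submatrix ?_ _
    rw [Matrix.IsHermitian, Matrix.conjTranspose_kronecker, Matrix.conjTranspose_one,
      (h.isHermitian a).eq]
  projections :=
    { idem := fun a => by
        rw [IsIdempotentElem, ← onHead_mul, (h.projections.idem a).eq]
      ortho := fun a b hab => by
        simp only
        rw [← onHead_mul, h.projections.ortho hab]
        ext; simp [QSteer.onHead]
      complete := by rw [← onHead_sum, h.projections.complete, onHead_one] }

theorem assemblage_apply {X O : Type*} (ρ : Matrix (m × n) (m × n) ℂ) (M : X → O → Matrix m m ℂ)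
    (x : X) (a : O) (j j' : n) :
    assemblage ρ M x a j j' = ∑ i, ∑ i', M x a i i' * ρ (i', j) (i, j') := by
  simp [assemblage, traceA, Matrix.mul_apply, Fintype.sum_prod_type, Matrix.one_apply]

theorem sum_copies_diag {k : ℕ} (ρ : Matrix (m × n) (m × n) ℂ) :
    ∑ v : Fin k → n, ∑ w : Fin k → m, ∏ t, ρ (w t, v t) (w t, v t) = ρ.trace ^ k := by
  have e : ∀ v : Fin k → n, ∑ w : Fin k → m, ∏ t, ρ (w t, v t) (w t, v t) =
      ∏ t, ∑ i, ρ (i, v t) (i, v t) := fun v => by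
    rw [Fintype.prod_sum]
  simp only [e]
  rw [← Fintype.prod_sum fun (_ : Fin k) (j : n) => ∑ i, ρ (i, j) (i, j)]
  rw [Finset.prod_const, Finset.card_univ, Fintype.card_fin, Matrix.trace, Fintype.sum_prod_type,
    Finset.sum_comm]
  rfl

theorem traceTail_assemblage_copies {X O : Type*} (k : ℕ) {ρ : Matrix (m × n) (m × n) ℂ}
    (hρ : ρ.trace = 1) (M : X → O → Matrix m m ℂ) (x : X) (a : O) :
    traceTail (assemblage (copies (k + 1) ρ) (fun x a => onHead k (M x a)) x a) =
      assemblage ρ M x a := by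
  ext j j'
  -- Alice acts trivially on the tail, so the unmeasured copies contribute only a scalar; these
  -- scalars sum over `v` to `(Tr ρ)^k = 1`.
  have e : ∀ v : Fin k → n,
      assemblage (copies (k + 1) ρ) (fun x a => onHead k (M x a)) x a (Fin.cons j v)
        (Fin.cons j' v) =
      (∑ w : Fin k → m, ∏ t, ρ (w t, v t) (w t, v t)) * assemblage ρ M x a j j' := by
    intro v
    rw [assemblage_apply, assemblage_apply, sum_fin_cons]
    simp only [sum_fin_cons (M := ℂ)]
    simp only [onHead, copies, Matrix.submatrix_apply, Matrix.kroneckerMap_apply, Matrix.of_apply,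
      Fin.consEquiv, Equiv.coe_fn_symm_mk, Fin.cons_zero, Fin.tail_cons, Fin.prod_univ_succ,
      Fin.cons_succ, Matrix.one_apply]
    simp only [mul_ite, mul_one, mul_zero, ite_mul, zero_mul, Finset.sum_ite_eq, Finset.mem_univ,
      if_true, Finset.sum_mul, Finset.mul_sum]
    refine Finset.sum_congr rfl fun i _ => ?_
    rw [Finset.sum_comm]
    exact Finset.sum_congr rfl fun i' _ => Finset.sum_congr rfl fun w _ => by ring
  rw [traceTail_apply]
  simp only [e]
  rw [← Finset.sum_mul, sum_copies_diag, hρ, one_pow, one_mul]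

/-- A steerable state is `k`-copy steerable for every `k ≥ 1`: Alice may measure a single copy. -/
theorem IsSteerableProjective.isKCopySteerableProjective {ρ : Matrix (m × n) (m × n) ℂ}
    (h : IsSteerableProjective.{u} ρ) (hρ : ρ.trace = 1) {k : ℕ} (hk : 1 ≤ k) :
    IsKCopySteerableProjective.{u} k ρ := by
  obtain ⟨k, rfl⟩ := Nat.exists_eq_add_of_le' hk
  obtain ⟨r, s, M, hM, hσ⟩ := h
  refine ⟨r, s, fun x a => onHead k (M x a), fun x => (hM x).onHead k, fun hL => hσ ?_⟩
  have := hL.traceTail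
  simpa only [traceTail_assemblage_copies k hρ M] using this

/-! ### The three-setting Pauli steering inequality and its violation. -/

/-- The Pauli matrices `σ_x`, `σ_y`, `σ_z`. -/
def pauli : Fin 3 → Matrix (Fin 2) (Fin 2) ℂ :=
  ![!![0, 1; 1, 0], !![0, -Complex.I; Complex.I, 0], !![1, 0; 0, -1]]

/-- The outcomes `±1` of a Pauli measurement. -/
def pauliSign : Fin 2 → ℂ := ![1, -1]

/-- The spectral projections of the Pauli matrices. -/
def pauliProj (x : Fin 3) (a : Fin 2) : Matrix (Fin 2) (Fin 2) ℂ :=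
  (1 / 2 : ℂ) • (1 + pauliSign a • pauli x)

theorem pauli_isHermitian (x : Fin 3) : (pauli x).IsHermitian := by
  ext i j
  fin_cases x <;> fin_cases i <;> fin_cases j <;> simp [pauli]

theorem pauli_mul_self (x : Fin 3) : pauli x * pauli x = 1 := by
  ext i j
  fin_cases x <;> fin_cases i <;> fin_cases j <;> simp [pauli]

theorem isProjectiveMeasurement_pauliProj (x : Fin 3) :
    IsProjectiveMeasurement (pauliProj x) where
  isHermitian a := by
    have h := (pauli_isHermitian x).eq
    rw [Matrix.IsHermitian, pauliProj, Matrix.conjTranspose_smul, Matrix.conjTranspose_add,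
      Matrix.conjTranspose_smul, h, Matrix.conjTranspose_one]
    fin_cases a <;> simp [pauliSign]
  projections :=
    { idem := fun a => by
        have h := pauli_mul_self x
        fin_cases a <;> simp only [IsIdempotentElem, pauliProj, pauliSign] <;>
          simp [mul_add, add_mul, h, smul_smul] <;> module
      ortho := fun a b hab => by
        have h := pauli_mul_self x
        fin_cases a <;> fin_cases b <;> simp [pauliProj, pauliSign] at hab ⊢ <;>
          simp [mul_add, add_mul, h] <;> module
      complete := by
        simp only [Fin.sum_univ_two, pauliProj, pauliSign, Matrix.cons_val_zero,
          Matrix.cons_val_one]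
        module }

/-- Bob's conditional states when Alice makes a Pauli measurement on the isotropic state. -/
theorem assemblage_isotropicState_two_pauliProj (F : ℝ) (x : Fin 3) (a i j : Fin 2) :
    assemblage (isotropicState 2 F) pauliProj x a i j =
      (1 / 4) * ((1 : Matrix (Fin 2) (Fin 2) ℂ) i j +
        pauliSign a * (((4 * F - 1) / 3 : ℝ) : ℂ) * pauli x j i) := by
  rw [assemblage_apply]
  fin_cases x <;> fin_cases a <;> fin_cases i <;> fin_cases j <;>
    simp [pauliProj, pauliSign, pauli, isotropicState, maxEntangledProj_two_apply,
      Matrix.one_apply] <;> ring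

/-- For trace one, the squared Bloch length is `1 - 4 det τ`. The entrywise pairing is `Tr(σᵀ τ)`,
which only flips the sign of the `y` component. -/
theorem bloch_sq_le {τ : Matrix (Fin 2) (Fin 2) ℂ} (h : IsDensityMatrix τ) :
    ∑ x, (∑ i, ∑ j, pauli x i j * τ i j).re ^ 2 ≤ 1 := by
  have hdet := h.posSemidef.det_nonneg
  have htr := h.trace_eq_one
  have h10 : τ 1 0 = star (τ 0 1) := (h.posSemidef.isHermitian.apply 1 0).symm
  have h00 := (Complex.nonneg_iff.1 (h.posSemidef.diag_nonneg (i := 0))).2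
  have h11 := (Complex.nonneg_iff.1 (h.posSemidef.diag_nonneg (i := 1))).2
  rw [Matrix.det_fin_two, h10] at hdet
  have hd := (Complex.nonneg_iff.1 hdet).1
  have ht := congrArg Complex.re htr
  simp [Matrix.trace, Fin.sum_univ_two] at ht
  simp [← h00, ← h11] at hd
  simp [Fin.sum_univ_succ, pauli, h10]
  have e : (τ 1 1).re = 1 - (τ 0 0).re := by linarith
  rw [e] at hd ⊢
  nlinarith

/-- The three-setting linear steering inequality for the Pauli measurements. -/
theorem pauli_response_sum_le {τ : Matrix (Fin 2) (Fin 2) ℂ} (h : IsDensityMatrix τ)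
    (q : Fin 3 → Fin 2 → ℝ) (hq0 : ∀ x a, 0 ≤ q x a) (hq1 : ∀ x, ∑ a, q x a = 1) :
    ∑ x, ∑ a, q x a * (∑ i, ∑ j, (pauliSign a * pauli x i j) * τ i j).re ≤ √3 := by
  set r : Fin 3 → ℝ := fun x => (∑ i, ∑ j, pauli x i j * τ i j).re with hr
  have hb : ∑ x, r x ^ 2 ≤ 1 := bloch_sq_le h
  have e : ∀ x a, (∑ i, ∑ j, (pauliSign a * pauli x i j) * τ i j).re =
      (pauliSign a).re * r x := by
    intro x a
    have : pauliSign a = ((pauliSign a).re : ℂ) := by fin_cases a <;> simp [pauliSign]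
    rw [hr, ← Complex.re_ofReal_mul, ← this]
    simp only [Finset.mul_sum, mul_assoc]
  have hc : ∀ x, (q x 0 - q x 1) ^ 2 ≤ 1 := by
    intro x
    have h1 := hq1 x
    rw [Fin.sum_univ_two] at h1
    have := hq0 x 0
    have := hq0 x 1
    nlinarith
  have e2 : ∑ x, ∑ a, q x a * (∑ i, ∑ j, (pauliSign a * pauli x i j) * τ i j).re =
      ∑ x, (q x 0 - q x 1) * r x := by
    refine Finset.sum_congr rfl fun x _ => ?_
    rw [Fin.sum_univ_two, e, e]
    simp [pauliSign]
    ring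
  rw [e2]
  -- Cauchy–Schwarz between the response vector, of squared length at most 3, and the Bloch vector.
  refine Real.le_sqrt_of_sq_le ((Finset.sum_mul_sq_le_sq_mul_sq _ _ _).trans ?_)
  have h3 : ∑ x, (q x 0 - q x 1) ^ 2 ≤ 3 := by
    refine (Finset.sum_le_sum fun x _ => hc x).trans ?_
    simp
  calc _ ≤ (3 : ℝ) * 1 := mul_le_mul h3 hb (Finset.sum_nonneg fun x _ => sq_nonneg _) (by norm_num)
    _ = 3 := mul_one 3

/-- The two-qubit isotropic state violates the three-setting steering inequality as soon as
`√3 < 4 F - 1`. -/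
theorem isSteerableProjective_isotropicState_two {F : ℝ} (h : √3 < 4 * F - 1) :
    IsSteerableProjective.{u} (isotropicState 2 F) := by
  refine ⟨3, 2, pauliProj, isProjectiveMeasurement_pauliProj, fun hL => ?_⟩
  have hle := hL.steering_inequality (fun x a i j => pauliSign a * pauli x i j) √3
    fun τ q hτ hq0 hq1 => pauli_response_sum_le hτ q hq0 hq1
  -- Bob's conditional states contain transposed Pauli matrices, matching the entrywise pairing:
  -- each of the six terms is `(1/4) · ((4F-1)/3) · Tr(σ²) = (4F-1)/6`.
  have e : ∑ x, ∑ a, (∑ i, ∑ j, pauliSign a * pauli x i j *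
      assemblage (isotropicState 2 F) pauliProj x a i j).re = 4 * F - 1 := by
    simp only [assemblage_isotropicState_two_pauliProj]
    simp [Fin.sum_univ_succ, pauli, pauliSign]
    ring
  linarith

end QSteer

end

theorem proposition7 (k : ℕ) (hk : 7 ≤ k) (α : ℝ) (hα : α ∈ Set.Ioo (0 : ℝ) 1)
    (F : ℝ) (hF : F ∈ Set.Icc (0 : ℝ) 1)
    (hneg : QSteer.condKaniadakisEntropy α (QSteer.isotropicState 2 F) < 0) :
    QSteer.IsKCopySteerableProjective.{u} k (QSteer.isotropicState 2 F) := by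
  have h := QSteer.half_lt_purity_of_condKaniadakisEntropy_neg hα hF hneg
  have hF0 := hF.1
  -- `12 (F² + (1-F)²/3) = (4F-1)² + 3`.
  have hsq : 3 < (4 * F - 1) ^ 2 := by nlinarith
  -- Otherwise `F ≥ 0` puts `4F - 1` in `[-1, 0]`, with square at most 1.
  have hpos : 0 < 4 * F - 1 := by
    by_contra! hle
    nlinarith
  exact (QSteer.isSteerableProjective_isotropicState_two
    ((Real.sqrt_lt' hpos).2 hsq)).isKCopySteerableProjective
      (QSteer.trace_isotropicState_two F) (by omega)
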